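/- Let $X$ be a connected compact metric space (non-empty) with metric $\rho$, and let $f:[0,\infty)\times X\to X$ be a semiflow of homeomorphisms: $f$ is continuous, each $f(t,\cdot)$ is a homeomorphism of $X$ onto a subset of $X$, $f(0,x)=x$ and $f(t,f(t',x))=f(t+t',x)$ for all $t,t'\ge 0$, $x\in X$. Fix $T>0$. For $\varepsilon>0$ and $x\in X$, an $(x,\varepsilon)$-motion is a (not necessarily continuous) map $g:[0,\infty)\to X$ with $g(0)=x$ and $$\rho\bigl(g(t+\tau),f(\tau,g(t))\bigr)<\varepsilon\qquad\text{for all } t\ge 0,\ \tau\in[0,T].$$ A point $y$ is an $\omega$-limit point of $g$ if $g(t_i)\to y$ for some sequence $t_i\to\infty$. Let $\omega^\varepsilon(x)$ be the set of all $\omega$-limit points of all $(x,\varepsilon)$-motions, and put $$\omega^0(x)=\bigcap_{\varepsilon>0}\omega^\varepsilon(x),\qquad \omega^\varepsilon_f=\bigcup_{x\in X}\omega^\varepsilon(x),\qquad \omega^0_f=\bigcup_{x\in X}\omega^0(x).$$ With $\rho^*(z,W)=\inf_{w\in W}\rho(z,w)$, define for an $(x,\varepsilon)$-motion $g$ and $\gamma>0$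 the relaxation times $$\tau_1^\varepsilon(g,\gamma)=\inf\{t\ge 0:\rho^*(g(t),\omega^\varepsilon(x))<\gamma\},$$ $$\tau_2^\varepsilon(g,\gamma)=\overline{\mathrm{mes}}\{t\ge 0:\rho^*(g(t),\omega^\varepsilon(x))\ge\gamma\},$$ $$\tau_3^\varepsilon(g,\gamma)=\inf\{t\ge 0:\rho^*(g(t'),\omega^\varepsilon(x))<\gamma\text{ for all }t'>t\},$$ $$\eta_3^\varepsilon(g,\gamma)=\inf\{t\ge 0:\rho^*(g(t'),\omega^\varepsilon_f)<\gamma\text{ for all }t'>t\},$$ where $\overline{\mathrm{mes}}$ is the outer Lebesgue measure. The semiflow $f$ possesses $\tau^0_i$-slow relaxations (respectively $\eta^0_3$-slow relaxations) if there are $\gamma>0$, numbers $\varepsilon_j>0$ with $\varepsilon_j\to 0$, points $x_j\in X$ and $(x_j,\varepsilon_j)$-motions $g_j$ such that $\tau_i^{\varepsilon_j}(g_j,\gamma)\to\infty$ (respectively $\eta_3^{\varepsilon_j}(g_j,\gamma)\to\infty$) as $j\to\infty$. **Theorem 4.6.** If $\omega^0_f$ is connected, then $f$ possesses none of $\tau^0_1$-,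 $\tau^0_2$-, $\tau^0_3$- and $\eta^0_3$-slow relaxations. If $\omega^0_f$ is disconnected, then $f$ possesses all four of them: $\tau^0_1$-, $\tau^0_2$-, $\tau^0_3$- and $\eta^0_3$-slow relaxations. -/

import Mathlib

open Filter
open scoped NNReal ENNReal Topology

namespace Perturbed

variable {X : Type*} [MetricSpace X]

/-- Here `f : Flow ℝ≥0 X` is a jointly continuous semiflow on `X` (time `t ≥ 0`).
`IsEpsMotion f T ε x g` says that the (possibly discontinuous) map `g : [0,∞) → X` is an
`(x, ε, T)`-motion of `f`: it starts at `x` and on every time window of length at most `T`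
it departs from the true motion by less than `ε`. -/
def IsEpsMotion (f : Flow ℝ≥0 X) (T : ℝ≥0) (ε : ℝ) (x : X) (g : ℝ≥0 → X) : Prop :=
  g 0 = x ∧ ∀ t τ : ℝ≥0, τ ≤ T → dist (g (t + τ)) (f τ (g t)) < ε

/-- The `ω`-limit points of an arbitrary map `g : [0,∞) → X`. -/
def limitPoints (g : ℝ≥0 → X) : Set X :=
  {y | ∃ s : ℕ → ℝ≥0, Tendsto s atTop atTop ∧ Tendsto (fun n => g (s n)) atTop (𝓝 y)}

/-- `ω^ε(x)`: all `ω`-limit points of all `(x, ε, T)`-motions. -/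
def omegaEps (f : Flow ℝ≥0 X) (T : ℝ≥0) (ε : ℝ) (x : X) : Set X :=
  {y | ∃ g : ℝ≥0 → X, IsEpsMotion f T ε x g ∧ y ∈ limitPoints g}

/-- `ω^0(x) = ⋂_{ε > 0} ω^ε(x)`. -/
def omegaZero (f : Flow ℝ≥0 X) (T : ℝ≥0) (x : X) : Set X :=
  {y | ∀ ε : ℝ, 0 < ε → y ∈ omegaEps f T ε x}

/-- The total set `ω^ε_f = ⋃_x ω^ε(x)`. -/
def totalOmegaEps (f : Flow ℝ≥0 X) (T : ℝ≥0) (ε : ℝ) : Set X :=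
  ⋃ x : X, omegaEps f T ε x

/-- The total set `ω^0_f = ⋃_x ω^0(x)`. -/
def totalOmegaZero (f : Flow ℝ≥0 X) (T : ℝ≥0) : Set X :=
  ⋃ x : X, omegaZero f T x

/-- Time of the first entry of `g` into the `γ`-neighbourhood of `W`. -/
noncomputable def firstEntry (g : ℝ≥0 → X) (W : Set X) (γ : ℝ) : ℝ≥0∞ :=
  ⨅ (t : ℝ≥0) (_ : Metric.infDist (g t) W < γ), (t : ℝ≥0∞)

/-- Outer Lebesgue measure of the set of times that `g` spends outside the
`γ`-neighbourhood of `W` (a Mathlib measure is the outer measure on non-measurable sets). -/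
noncomputable def timeOutside (g : ℝ≥0 → X) (W : Set X) (γ : ℝ) : ℝ≥0∞ :=
  MeasureTheory.volume ((fun t : ℝ≥0 => (t : ℝ)) '' {t | γ ≤ Metric.infDist (g t) W})

/-- Time of the final entry of `g` into the `γ`-neighbourhood of `W`. -/
noncomputable def finalEntry (g : ℝ≥0 → X) (W : Set X) (γ : ℝ) : ℝ≥0∞ :=
  ⨅ (t : ℝ≥0) (_ : ∀ t' : ℝ≥0, t < t' → Metric.infDist (g t') W < γ), (t : ℝ≥0∞)

/-- Given a relaxation time `R ε x g γ` of an `(x, ε, T)`-motion `g` with accuracy `γ`: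
for some `γ > 0` there are `(x_j, ε_j, T)`-motions with `ε_j → 0` along which it tends to
infinity. -/
def SlowRelaxations (f : Flow ℝ≥0 X) (T : ℝ≥0)
    (R : ℝ → X → (ℝ≥0 → X) → ℝ → ℝ≥0∞) : Prop :=
  ∃ γ : ℝ, 0 < γ ∧ ∃ (ε : ℕ → ℝ) (x : ℕ → X) (g : ℕ → ℝ≥0 → X),
    (∀ j, 0 < ε j) ∧ Tendsto ε atTop (𝓝 0) ∧
    (∀ j, IsEpsMotion f T (ε j) (x j) (g j)) ∧
    Tendsto (fun j => R (ε j) (x j) (g j) γ) atTop (𝓝 ⊤)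

/-- `τ⁰₁`-slow relaxations. -/
def TauOneSlow (f : Flow ℝ≥0 X) (T : ℝ≥0) : Prop :=
  SlowRelaxations f T fun ε x g γ => firstEntry g (omegaEps f T ε x) γ

/-- `τ⁰₂`-slow relaxations. -/
def TauTwoSlow (f : Flow ℝ≥0 X) (T : ℝ≥0) : Prop :=
  SlowRelaxations f T fun ε x g γ => timeOutside g (omegaEps f T ε x) γ

/-- `τ⁰₃`-slow relaxations. -/
def TauThreeSlow (f : Flow ℝ≥0 X) (T : ℝ≥0) : Prop :=
  SlowRelaxations f T fun ε x g γ => finalEntry g (omegaEps f T ε x) γ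

/-- `η⁰₃`-slow relaxations. -/
def EtaThreeSlow (f : Flow ℝ≥0 X) (T : ℝ≥0) : Prop :=
  SlowRelaxations f T fun ε _ g γ => finalEntry g (totalOmegaEps f T ε) γ

end Perturbed

open Filter
open scoped NNReal ENNReal Topology

/-! Everything is translated into chains: `y` lies in `ω^0(x)` iff arbitrarily fine chains lead from
`x` to `y` and from `y` to itself (`mem_omegaZero_iff`), so `ω^0_f` is the chain recurrent set.

If `ω^0_f` is connected, its points all reach one another, so every `ω^0(x)` is all of `ω^0_f`. A
slow relaxation would give late points of motions with errors tending to `0`, far from `ω^0_f`;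
their limit has a complete backward orbit, which forces it to be chain recurrent.

If `ω^0_f` is disconnected, it is a proper subset of the continuum `⋂ f(nT, X)`, so some point `z 0`
outside it has a backward orbit `z`. The set reaching `z 0` and the set reached from it are disjoint
and closed. The orbit of `z j` lingers in the first while its limit points lie in the second: this
is `τ₁`-slowness, and `τ₁ ≤ τ₂ ≤ τ₃`. The late arrival at `z 0`, away from `ω^0_f`, gives
`η₃`-slowness. -/

namespace Perturbed

/-! ### Chains and their relation to motions -/

section Chains

variable {X : Type*} [MetricSpace X] (f : Flow ℝ≥0 X) (T : ℝ≥0)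

/-- A step of a chain: flow for a time between `T` and `2T`, then jump by less than `δ`. -/
def ChainStep (δ : ℝ) (x y : X) : Prop :=
  ∃ t : ℝ≥0, T ≤ t ∧ t ≤ 2 * T ∧ dist (f t x) y < δ

/-- `y` is the end of a nontrivial `δ`-chain that starts at `x`. -/
def EpsChain (δ : ℝ) : X → X → Prop :=
  Relation.TransGen (ChainStep f T δ)

/-- `y` is the end of `δ`-chains from `x` for arbitrarily small `δ`. -/
def ChainReach (x y : X) : Prop :=
  ∀ δ : ℝ, 0 < δ → EpsChain f T δ x y

variable {f T}

theorem ChainStep.mono {δ δ' : ℝ} (h : δ ≤ δ') {x y : X} (hxy : ChainStep f T δ x y) :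
    ChainStep f T δ' x y := by
  obtain ⟨t, h1, h2, h3⟩ := hxy
  exact ⟨t, h1, h2, h3.trans_le h⟩

theorem EpsChain.mono {δ δ' : ℝ} (h : δ ≤ δ') {x y : X} (hxy : EpsChain f T δ x y) :
    EpsChain f T δ' x y :=
  Relation.TransGen.mono (p := ChainStep f T δ') (fun _ _ => ChainStep.mono h) _ _ hxy

theorem ChainReach.trans {x y z : X} (hxy : ChainReach f T x y) (hyz : ChainReach f T y z) :
    ChainReach f T x z :=
  fun δ hδ => Relation.TransGen.trans (hxy δ hδ) (hyz δ hδ)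

theorem IsEpsMotion.mono {ε ε' : ℝ} (h : ε ≤ ε') {x : X} {g : ℝ≥0 → X}
    (hg : IsEpsMotion f T ε x g) : IsEpsMotion f T ε' x g :=
  ⟨hg.1, fun t τ hτ => (hg.2 t τ hτ).trans_le h⟩

theorem omegaEps_mono {ε ε' : ℝ} (h : ε ≤ ε') (x : X) :
    omegaEps f T ε x ⊆ omegaEps f T ε' x :=
  fun _ ⟨g, hg, hy⟩ => ⟨g, hg.mono h, hy⟩

theorem totalOmegaEps_mono {ε ε' : ℝ} (h : ε ≤ ε') :
    totalOmegaEps f T ε ⊆ totalOmegaEps f T ε' :=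
  Set.iUnion_mono fun x => omegaEps_mono h x

theorem isEpsMotion_orbit {ε : ℝ} (hε : 0 < ε) (x : X) :
    IsEpsMotion f T ε x (fun t => f t x) := by
  refine ⟨f.map_zero_apply x, fun t τ _ => ?_⟩
  rw [← f.map_add, add_comm, dist_self]
  exact hε

variable (f) in
theorem exists_dist_flow_lt [CompactSpace X] (S : ℝ≥0) {ε : ℝ} (hε : 0 < ε) :
    ∃ δ > 0, ∀ t ≤ S, ∀ x y : X, dist x y < δ → dist (f t x) (f t y) < ε := by
  have hK : IsCompact (Set.Icc (0 : ℝ≥0) S ×ˢ (Set.univ : Set X)) := isCompact_Icc.prod isCompact_univ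
  have hc : ContinuousOn (fun p : ℝ≥0 × X => f p.1 p.2) (Set.Icc (0 : ℝ≥0) S ×ˢ Set.univ) :=
    (f.continuous continuous_fst continuous_snd).continuousOn
  obtain ⟨δ, hδ, h⟩ :=
    Metric.uniformContinuousOn_iff.1 (hK.uniformContinuousOn_of_continuous hc) ε hε
  refine ⟨δ, hδ, fun t ht x y hxy => h (t, x) ?_ (t, y) ?_ ?_⟩
  · exact ⟨⟨zero_le, ht⟩, trivial⟩
  · exact ⟨⟨zero_le, ht⟩, trivial⟩
  · simpa [Prod.dist_eq] using hxy

-- Only the first flow arc and the last jump change; arcs last at most `2T`, so uniform continuity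
-- applies. The two ends are moved in succession because a one-step chain has both in the same step.
variable (f T) in
theorem exists_epsChain_perturb [CompactSpace X] {δ : ℝ} (hδ : 0 < δ) :
    ∃ δ' > 0, ∀ x x' y y' : X, EpsChain f T δ' x y → dist x' x < δ' → dist y y' < δ' →
      EpsChain f T δ x' y' := by
  obtain ⟨η, hη, hf⟩ := exists_dist_flow_lt f (2 * T) (half_pos (half_pos hδ))
  refine ⟨min η (δ / 4), lt_min hη (by linarith), fun x x' y y' h hx hy => ?_⟩
  have h1 : EpsChain f T (δ / 2) x' y := by
    obtain ⟨z, ⟨t, ht, ht', hz⟩, hzy⟩ := Relation.TransGen.head'_iff.1 h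
    refine Relation.TransGen.head'_iff.2 ⟨z, ⟨t, ht, ht', ?_⟩,
      Relation.ReflTransGen.mono (fun _ _ => ChainStep.mono ?_) _ _ hzy⟩
    · have := hf t ht' x' x (hx.trans_le (min_le_left _ _))
      have := hz.trans_le (min_le_right _ _)
      linarith [dist_triangle (f t x') (f t x) z]
    · exact (min_le_right _ _).trans (by linarith)
  obtain ⟨z, hxz, t, ht, ht', hz⟩ := Relation.TransGen.tail'_iff.1 h1
  refine Relation.TransGen.tail'_iff.2
    ⟨z, Relation.ReflTransGen.mono (fun _ _ => ChainStep.mono (by linarith)) _ _ hxz,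
      t, ht, ht', ?_⟩
  have := hy.trans_le (min_le_right _ _)
  linarith [dist_triangle (f t z) y y']

theorem ChainReach.of_frequently_nhds [CompactSpace X] {x y : X}
    (h : ∃ᶠ p : X × X in 𝓝 (x, y), ChainReach f T p.1 p.2) : ChainReach f T x y := by
  intro δ hδ
  obtain ⟨δ', hδ', hp⟩ := exists_epsChain_perturb f T hδ
  obtain ⟨⟨a, b⟩, hab, hd⟩ := (h.and_eventually (Metric.ball_mem_nhds (x, y) hδ')).exists
  rw [Prod.dist_eq, max_lt_iff] at hd
  refine hp a x b y (hab δ' hδ') ?_ hd.2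
  rw [dist_comm]
  exact hd.1

variable (f T) in
theorem isClosed_chainReach [CompactSpace X] :
    IsClosed {p : X × X | ChainReach f T p.1 p.2} :=
  isClosed_iff_frequently.2 fun _ h => ChainReach.of_frequently_nhds h

-- Any duration of at least `T` splits into pieces of length `T` and a last one in `[T, 2T]`. A
-- piece of length `T + r` is compared with the flow through the point `g (a + T)`.
variable (f) in
theorem exists_epsChain_of_motion [CompactSpace X] (hT : 0 < T) {δ : ℝ} (hδ : 0 < δ) :
    ∃ ε > 0, ∀ (x : X) (g : ℝ≥0 → X), IsEpsMotion f T ε x g →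
      ∀ a b : ℝ≥0, a + T ≤ b → EpsChain f T δ (g a) (g b) := by
  obtain ⟨η, hη, hf⟩ := exists_dist_flow_lt f T (half_pos hδ)
  refine ⟨min η (δ / 2), lt_min hη (half_pos hδ), fun x g hg => ?_⟩
  have key : ∀ (n : ℕ) (a b : ℝ≥0), a + T ≤ b → b ≤ a + (n + 2) * T →
      EpsChain f T δ (g a) (g b) := by
    have single : ∀ a b : ℝ≥0, a + T ≤ b → b ≤ a + 2 * T → EpsChain f T δ (g a) (g b) := by
      intro a b hab hba
      obtain ⟨r, rfl⟩ := exists_add_of_le hab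
      have hr : r ≤ T := by
        rw [add_assoc, two_mul] at hba
        simpa using hba
      refine Relation.TransGen.single ⟨T + r, le_self_add, by rw [two_mul]; gcongr, ?_⟩
      have h1 := (hg.2 a T le_rfl).trans_le (min_le_left _ _)
      have h2 := (hg.2 (a + T) r hr).trans_le (min_le_right _ _)
      have h3 := hf r hr _ _ h1
      rw [add_comm T r, f.map_add, dist_comm]
      linarith [dist_triangle (g (a + T + r)) (f r (g (a + T))) (f r (f T (g a)))]
    intro n
    induction n with
    | zero => intro a b h1 h2; exact single a b h1 (by simpa using h2)
    | succ n ih =>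
      intro a b h1 h2
      rcases le_total b (a + 2 * T) with h | h
      · exact single a b h1 h
      · refine (single a (a + T) le_rfl ?_).trans (ih (a + T) b ?_ ?_)
        · rw [two_mul]; gcongr; exact le_self_add
        · rwa [add_assoc, ← two_mul]
        · refine h2.trans (le_of_eq ?_)
          push_cast; ring
  intro a b hab
  obtain ⟨n, hn⟩ := Archimedean.arch b hT
  refine key n a b hab ?_
  rw [nsmul_eq_mul] at hn
  refine hn.trans (le_trans ?_ le_add_self)
  gcongr
  exact le_self_add

theorem chainReach_flow [CompactSpace X] (hT : 0 < T) {t : ℝ≥0} (ht : T ≤ t) (x : X) :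
    ChainReach f T x (f t x) := by
  intro δ hδ
  obtain ⟨ε, hε, h⟩ := exists_epsChain_of_motion f hT hδ
  have := h x _ (isEpsMotion_orbit hε x) 0 t (by simpa using ht)
  simpa using this

-- A motion returning near `y` at widely separated times supplies all three chains; the last starts
-- at `g T`, which is close to `f T x`.
variable (f) in
theorem exists_epsChain_of_mem_omegaEps [CompactSpace X] (hT : 0 < T) {δ : ℝ} (hδ : 0 < δ) :
    ∃ ε > 0, ∀ x y y' : X, y ∈ omegaEps f T ε x → dist y y' < ε →
      EpsChain f T δ x y' ∧ EpsChain f T δ y' y' ∧ EpsChain f T δ (f T x) y' := by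
  obtain ⟨δ', hδ', hp⟩ := exists_epsChain_perturb f T hδ
  obtain ⟨ε, hε, hm⟩ := exists_epsChain_of_motion f hT hδ'
  refine ⟨min ε (δ' / 2), lt_min hε (half_pos hδ'), ?_⟩
  rintro x y y' ⟨g, hg, s, hs, hgs⟩ hyy
  have hyy' := hyy.trans_le (min_le_right _ _)
  replace hm := hm x g (hg.mono (min_le_left _ _))
  have hnear : ∀ᶠ n in atTop, dist (g (s n)) y' < δ' := by
    filter_upwards [hgs (Metric.ball_mem_nhds y (half_pos hδ'))] with n hn
    have : dist (g (s n)) y < δ' / 2 := hn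
    linarith [dist_triangle (g (s n)) y y']
  obtain ⟨n, hn, hn1⟩ := (hnear.and (hs.eventually_ge_atTop (T + T))).exists
  obtain ⟨m, hm', hm1⟩ := (hnear.and (hs.eventually_ge_atTop (s n + T))).exists
  refine ⟨?_, ?_, ?_⟩
  · refine hp _ _ _ _ (hm 0 (s n) ?_) ?_ hn
    · rw [zero_add]; exact le_self_add.trans hn1
    · rw [hg.1, dist_self]; exact hδ'
  · exact hp _ _ _ _ (hm _ _ hm1) (by rwa [dist_comm]) hm'
  · refine hp _ _ _ _ (hm T (s n) hn1) ?_ hn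
    have := (hg.2 0 T le_rfl).trans_le (min_le_right _ _)
    rw [zero_add, hg.1, dist_comm] at this
    linarith

end Chains

/-! ### Realising chains by motions -/

theorem exists_path_of_transGen {α : Type*} {r : α → α → Prop} {x y : α}
    (h : Relation.TransGen r x y) :
    ∃ (n : ℕ) (z : ℕ → α), z 0 = x ∧ z (n + 1) = y ∧ ∀ i ≤ n, r (z i) (z (i + 1)) := by
  induction h with
  | @single b hb =>
    refine ⟨0, fun i => if i = 0 then x else b, by simp, by simp, fun i hi => ?_⟩
    obtain rfl : i = 0 := by omega
    simpa using hb
  | @tail b c _ hbc ih =>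
    obtain ⟨n, z, h0, h1, h2⟩ := ih
    refine ⟨n + 1, fun i => if i ≤ n + 1 then z i else c, by simp [h0], by simp, fun i hi => ?_⟩
    rcases hi.lt_or_eq with hi | rfl
    · have h3 : i ≤ n + 1 := by omega
      have h4 : i + 1 ≤ n + 1 := by omega
      simpa [h3, h4] using h2 i (by omega)
    · simpa [h1] using hbc

/-- Follow a path from `x` to `y`, then run round a loop at `y` forever. -/
theorem exists_seq_frequently_eq {α : Type*} {r : α → α → Prop} {x y : α}
    (hxy : Relation.TransGen r x y) (hyy : Relation.TransGen r y y) :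
    ∃ z : ℕ → α, z 0 = x ∧ (∀ i, r (z i) (z (i + 1))) ∧ ∃ᶠ i in atTop, z i = y := by
  obtain ⟨n, z, h0, h1, h2⟩ := exists_path_of_transGen hyy
  obtain ⟨m, w, k0, k1, k2⟩ := exists_path_of_transGen hxy
  refine ⟨fun i => if i ≤ m then w i else z ((i - (m + 1)) % (n + 1)), by simp [k0],
    fun i => ?_, frequently_atTop.2 fun a => ⟨(m + 1) + (n + 1) * a, ?_, ?_⟩⟩
  · rcases lt_trichotomy i m with hi | rfl | hi
    · have h3 : i + 1 ≤ m := hi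
      simpa [hi.le, h3] using k2 i hi.le
    · have := k2 i le_rfl
      rw [k1] at this
      simpa [h0] using this
    · obtain ⟨j, rfl⟩ := Nat.exists_eq_add_of_lt hi
      have e1 : m + j + 1 - (m + 1) = j := by omega
      have e2 : m + j + 1 + 1 - (m + 1) = j + 1 := by omega
      have e3 : ¬ m + j + 1 ≤ m := by omega
      have e4 : ¬ m + j + 1 + 1 ≤ m := by omega
      simp only [e1, e2, e3, e4, if_false]
      have hj : j % (n + 1) < n + 1 := Nat.mod_lt _ n.succ_pos
      have h5 := h2 (j % (n + 1)) (by omega)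
      rcases (Nat.succ_le_of_lt hj).lt_or_eq with h | h
      · have : (j + 1) % (n + 1) = j % (n + 1) + 1 := by
          rw [Nat.add_mod, Nat.mod_eq_of_lt (a := 1) (by omega)]
          exact Nat.mod_eq_of_lt h
        rwa [this]
      · have : (j + 1) % (n + 1) = 0 := by
          rw [← Nat.mod_add_mod, show j % (n + 1) + 1 = n + 1 from h, Nat.mod_self]
        rw [this, h0]
        rwa [show j % (n + 1) + 1 = n + 1 from h, h1] at h5
  · nlinarith
  · have e3 : ¬ m + 1 + (n + 1) * a ≤ m := by omega
    simp [e3, h0]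

section Chains

variable {X : Type*} [MetricSpace X] {f : Flow ℝ≥0 X} {T : ℝ≥0}

/-- There is a map that follows the flow from `z n` for the time `t n` and then jumps to
`z (n + 1)`. -/
theorem exists_eq_flow_between_jumps (f : Flow ℝ≥0 X) (hT : 0 < T) (z : ℕ → X) (t : ℕ → ℝ≥0)
    (ht : ∀ i, T ≤ t i) :
    ∃ g : ℝ≥0 → X, ∀ n, ∀ a < t n, g (∑ i ∈ Finset.range n, t i + a) = f a (z n) := by
  classical
  set s : ℕ → ℝ≥0 := fun n => ∑ i ∈ Finset.range n, t i with hs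
  have hsm : Monotone s := fun a b h => Finset.sum_le_sum_of_subset (Finset.range_mono h)
  have hs1 : ∀ n, s (n + 1) = s n + t n := fun n => Finset.sum_range_succ _ _
  have hex : ∀ u : ℝ≥0, ∃ n, u < s (n + 1) := by
    intro u
    obtain ⟨n, hn⟩ := Archimedean.arch u hT
    refine ⟨n, hn.trans_lt ?_⟩
    have : (n + 1) • T ≤ s (n + 1) := by
      simpa using Finset.card_nsmul_le_sum (Finset.range (n + 1)) t T fun i _ => ht i
    refine lt_of_lt_of_le ?_ this
    rw [succ_nsmul]
    exact lt_add_of_pos_right _ hT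
  refine ⟨fun u => f (u - s (Nat.find (hex u))) (z (Nat.find (hex u))), fun n a ha => ?_⟩
  have hfind : Nat.find (hex (s n + a)) = n := by
    rw [Nat.find_eq_iff]
    refine ⟨by rw [hs1]; gcongr, fun m hm => not_lt.2 ?_⟩
    exact (hsm hm).trans le_self_add
  change f (s n + a - s (Nat.find (hex (s n + a)))) (z (Nat.find (hex (s n + a)))) = _
  rw [hfind, add_tsub_cancel_left]

-- Arcs last at least `T`, so a window of length at most `T` meets at most one jump; past it, two
-- true orbits with `δ`-close starts are compared.
variable (f) in
theorem exists_motion_of_steps [CompactSpace X] (hT : 0 < T) {ε : ℝ} (hε : 0 < ε) :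
    ∃ δ > 0, ∀ z : ℕ → X, (∀ i, ChainStep f T δ (z i) (z (i + 1))) →
      ∃ (g : ℝ≥0 → X) (s : ℕ → ℝ≥0), IsEpsMotion f T ε (z 0) g ∧ Tendsto s atTop atTop ∧
        ∀ n, g (s n) = z n := by
  obtain ⟨δ, hδ, hf⟩ := exists_dist_flow_lt f T hε
  refine ⟨δ, hδ, fun z hz => ?_⟩
  choose t ht _ hd using hz
  obtain ⟨g, hg⟩ := exists_eq_flow_between_jumps f hT z t ht
  set s : ℕ → ℝ≥0 := fun n => ∑ i ∈ Finset.range n, t i with hs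
  have hs1 : ∀ n, s (n + 1) = s n + t n := fun n => Finset.sum_range_succ _ _
  have hsz : ∀ n, g (s n) = z n := fun n => by
    simpa [f.map_zero_apply] using hg n 0 (hT.trans_le (ht n))
  have hsn : ∀ n : ℕ, n • T ≤ s n := fun n => by
    simpa using Finset.card_nsmul_le_sum (Finset.range n) t T fun i _ => ht i
  have hsTop : Tendsto s atTop atTop :=
    tendsto_atTop_mono hsn (tendsto_id.atTop_nsmul_const hT)
  refine ⟨g, s, ⟨by simpa [hs] using hsz 0, fun u τ hτ => ?_⟩, hsTop, hsz⟩
  have hex : ∃ n, u < s (n + 1) :=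
    ((hsTop.comp (tendsto_add_atTop_nat 1)).eventually_gt_atTop u).exists
  classical
  obtain ⟨n, a, ha, rfl⟩ : ∃ n, ∃ a < t n, u = s n + a := by
    have hle : s (Nat.find hex) ≤ u := by
      rcases h : Nat.find hex with _ | m
      · simp [hs]
      · exact not_lt.1 (Nat.find_min hex (h ▸ Nat.lt_succ_self m))
    obtain ⟨a, ha⟩ := exists_add_of_le hle
    refine ⟨_, a, ?_, ha⟩
    have := Nat.find_spec hex
    rw [hs1] at this
    nth_rewrite 1 [ha] at this
    exact lt_of_add_lt_add_left this
  rw [hg n a ha, ← f.map_add, add_assoc]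
  rcases lt_or_ge (a + τ) (t n) with h | h
  · rw [hg n _ h, add_comm, dist_self]
    exact hε
  · obtain ⟨b, hb⟩ := exists_add_of_le h
    have hbτ : b < τ := by
      have : t n + b < t n + τ := by rw [← hb]; gcongr
      exact lt_of_add_lt_add_left this
    have hbT : b < t (n + 1) := hbτ.trans_le (hτ.trans (ht _))
    have h2 := hg (n + 1) b hbT
    rw [show s n + (a + τ) = s (n + 1) + b by rw [hb, hs1, add_assoc]]
    rw [h2, add_comm τ a, hb, add_comm (t n) b, f.map_add, dist_comm]
    exact hf b (hbτ.le.trans hτ) _ _ (hd n)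

theorem mem_omegaZero_iff [CompactSpace X] (hT : 0 < T) {x y : X} :
    y ∈ omegaZero f T x ↔ ChainReach f T x y ∧ ChainReach f T y y := by
  constructor
  · intro h
    have h1 : ∀ δ : ℝ, 0 < δ → EpsChain f T δ x y ∧ EpsChain f T δ y y := by
      intro δ hδ
      obtain ⟨ε, hε, he⟩ := exists_epsChain_of_mem_omegaEps f hT hδ
      have := he x y y (h ε hε) (by simpa using hε)
      exact ⟨this.1, this.2.1⟩
    exact ⟨fun δ hδ => (h1 δ hδ).1, fun δ hδ => (h1 δ hδ).2⟩
  · rintro ⟨hxy, hyy⟩ ε hε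
    obtain ⟨δ, hδ, h⟩ := exists_motion_of_steps f hT hε
    obtain ⟨z, rfl, hz, hfr⟩ := exists_seq_frequently_eq (hxy δ hδ) (hyy δ hδ)
    obtain ⟨g, s, hg, hs, hgs⟩ := h z hz
    obtain ⟨φ, hφ, hzφ⟩ := extraction_of_frequently_atTop hfr
    refine ⟨g, hg, s ∘ φ, hs.comp hφ.tendsto_atTop, ?_⟩
    simp [hgs, hzφ]

theorem mem_totalOmegaZero_iff [CompactSpace X] (hT : 0 < T) {y : X} :
    y ∈ totalOmegaZero f T ↔ ChainReach f T y y := by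
  constructor
  · intro h
    obtain ⟨x, hx⟩ := Set.mem_iUnion.1 h
    exact ((mem_omegaZero_iff hT).1 hx).2
  · exact fun h => Set.mem_iUnion.2 ⟨y, (mem_omegaZero_iff hT).2 ⟨h, h⟩⟩

theorem chainReach_flow_of_mem_omegaZero [CompactSpace X] (hT : 0 < T) {x y : X}
    (h : y ∈ omegaZero f T x) : ChainReach f T (f T x) y := by
  intro δ hδ
  obtain ⟨ε, hε, he⟩ := exists_epsChain_of_mem_omegaEps f hT hδ
  exact (he x y y (h ε hε) (by simpa using hε)).2.2

/-- Flowing forward loses no limit points. Hence along a backward orbit every `ω^0 (z k)` is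
contained in `ω^0 (z 0)`. -/
theorem omegaZero_subset_omegaZero_flow [CompactSpace X] (hT : 0 < T) (x : X) :
    omegaZero f T x ⊆ omegaZero f T (f T x) := fun _ hy =>
  (mem_omegaZero_iff hT).2
    ⟨chainReach_flow_of_mem_omegaZero hT hy, ((mem_omegaZero_iff hT).1 hy).2⟩

theorem omegaZero_subset_omegaZero_flow_mul [CompactSpace X] (hT : 0 < T) (k : ℕ) (x : X) :
    omegaZero f T x ⊆ omegaZero f T (f (k * T) x) := by
  induction k with
  | zero => simp [f.map_zero_apply]
  | succ k ih =>
    refine ih.trans ((omegaZero_subset_omegaZero_flow hT _).trans (subset_of_eq ?_))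
    rw [← f.map_add]
    push_cast
    ring_nf

theorem isClosed_totalOmegaZero [CompactSpace X] (hT : 0 < T) :
    IsClosed (totalOmegaZero f T) := by
  have : totalOmegaZero f T = (fun x => (x, x)) ⁻¹' {p : X × X | ChainReach f T p.1 p.2} :=
    Set.ext fun y => mem_totalOmegaZero_iff hT
  rw [this]
  exact (isClosed_chainReach f T).preimage (by fun_prop)

theorem omegaEps_nonempty [CompactSpace X] {ε : ℝ} (hε : 0 < ε) (x : X) :
    (omegaEps f T ε x).Nonempty := by
  obtain ⟨y, φ, hφ, hy⟩ := CompactSpace.tendsto_subseq fun n : ℕ => f (n : ℝ≥0) x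
  exact ⟨y, _, isEpsMotion_orbit hε x, fun n => (φ n : ℝ≥0),
    tendsto_natCast_atTop_atTop.comp hφ.tendsto_atTop, hy⟩

theorem omegaZero_nonempty [CompactSpace X] (x : X) : (omegaZero f T x).Nonempty := by
  obtain ⟨y, φ, hφ, hy⟩ := CompactSpace.tendsto_subseq fun n : ℕ => f (n : ℝ≥0) x
  exact ⟨y, fun ε hε => ⟨_, isEpsMotion_orbit hε x, fun n => (φ n : ℝ≥0),
    tendsto_natCast_atTop_atTop.comp hφ.tendsto_atTop, hy⟩⟩

/-- Upper semicontinuity at `0` of a monotone family of sets, on a compact set. -/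
theorem exists_disjoint_of_isCompact {W : ℝ → Set X} (hW : Monotone W) {K : Set X}
    (hK : IsCompact K) (h : ∀ p ∈ K, ∃ ε > 0, ∀ q ∈ W ε, ε ≤ dist q p) :
    ∃ ε > 0, Disjoint K (W ε) := by
  refine hK.induction_on ⟨1, one_pos, Set.empty_disjoint _⟩
    (fun s t hst ⟨ε, hε, ht⟩ => ⟨ε, hε, ht.mono_left hst⟩) ?_ ?_
  · rintro s t ⟨ε, hε, hs⟩ ⟨ε', hε', ht⟩
    exact ⟨min ε ε', lt_min hε hε', Set.disjoint_union_left.2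
      ⟨hs.mono_right (hW (min_le_left _ _)), ht.mono_right (hW (min_le_right _ _))⟩⟩
  · intro p hp
    obtain ⟨ε, hε, hq⟩ := h p hp
    refine ⟨_, mem_nhdsWithin_of_mem_nhds (Metric.ball_mem_nhds p hε), ε, hε, ?_⟩
    exact Set.disjoint_left.2 fun q hq1 hq2 => (hq q hq2).not_gt hq1

/-- A limit of points of `ω^ε(x)` as `ε → 0` is reached from `x` and from itself by fine chains,
hence lies in `ω^0(x)`. -/
theorem exists_disjoint_omegaEps [CompactSpace X] (hT : 0 < T) {K : Set X} (hK : IsCompact K)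
    {x : X} (h : Disjoint K (omegaZero f T x)) :
    ∃ ε > 0, Disjoint K (omegaEps f T ε x) := by
  refine exists_disjoint_of_isCompact (fun _ _ h => omegaEps_mono h x) hK fun p hp => ?_
  by_contra! hcon
  refine Set.disjoint_left.1 h hp ((mem_omegaZero_iff hT).2 ⟨fun δ hδ => ?_, fun δ hδ => ?_⟩) <;>
  · obtain ⟨ε, hε, he⟩ := exists_epsChain_of_mem_omegaEps f hT hδ
    obtain ⟨q, hq, hqp⟩ := hcon ε hε
    have := he x q p hq hqp
    first | exact this.1 | exact this.2.1

theorem exists_disjoint_totalOmegaEps [CompactSpace X] (hT : 0 < T) {K : Set X}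
    (hK : IsCompact K) (h : Disjoint K (totalOmegaZero f T)) :
    ∃ ε > 0, Disjoint K (totalOmegaEps f T ε) := by
  refine exists_disjoint_of_isCompact (fun _ _ h => totalOmegaEps_mono h) hK fun p hp => ?_
  by_contra! hcon
  refine Set.disjoint_left.1 h hp ((mem_totalOmegaZero_iff hT).2 fun δ hδ => ?_)
  obtain ⟨ε, hε, he⟩ := exists_epsChain_of_mem_omegaEps f hT hδ
  obtain ⟨q, hq, hqp⟩ := hcon ε hε
  obtain ⟨x, hx⟩ := Set.mem_iUnion.1 hq
  exact (he x q p hx hqp).2.1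

/-- The limits of long motions with errors tending to `0` lie on complete backward orbits. -/
theorem exists_backward_orbit [CompactSpace X] {ε : ℕ → ℝ} {x : ℕ → X} {g : ℕ → ℝ≥0 → X}
    {s : ℕ → ℝ≥0} {y : X} {U : Ultrafilter ℕ} (hU : (U : Filter ℕ) ≤ atTop)
    (hε : Tendsto ε atTop (𝓝 0)) (hg : ∀ j, IsEpsMotion f T (ε j) (x j) (g j))
    (hs : Tendsto s atTop atTop) (hy : Tendsto (fun j => g j (s j)) U (𝓝 y)) :
    ∃ z : ℕ → X, z 0 = y ∧ ∀ k, f T (z (k + 1)) = z k := by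
  -- A single ultrafilter makes the limits for all `k` exist at once, replacing a diagonal
  -- subsequence.
  have hlim : ∀ k : ℕ, ∃ w, Tendsto (fun j => g j (s j - k * T)) U (𝓝 w) := by
    intro k
    obtain ⟨w, -, hw⟩ := isCompact_univ.ultrafilter_le_nhds (U.map fun j => g j (s j - k * T))
      (by simp)
    exact ⟨w, hw⟩
  choose z hz using hlim
  refine ⟨z, ?_, fun k => ?_⟩
  · exact tendsto_nhds_unique (hz 0) (by simpa using hy)
  · have hc : Continuous (f T) := f.continuous continuous_const continuous_id
    have h1 := (hc.tendsto _).comp (hz (k + 1))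
    refine tendsto_nhds_unique h1 ?_
    refine (tendsto_iff_of_dist ?_).1 (hz k)
    refine squeeze_zero' (Eventually.of_forall fun _ => dist_nonneg) ?_ (hε.mono_left hU)
    -- Subtraction in `ℝ≥0` is truncated; it is genuine once `s j ≥ (k + 1) * T`.
    filter_upwards [hU (hs.eventually_ge_atTop ((k + 1 : ℕ) * T))] with j hj
    have := (hg j).2 (s j - (k + 1 : ℕ) * T) T le_rfl
    have e : s j - (k + 1 : ℕ) * T + T = s j - k * T := by
      obtain ⟨c, hc⟩ := exists_add_of_le (show ((k + 1 : ℕ) : ℝ≥0) * T ≤ s j from hj)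
      rw [hc, add_tsub_cancel_left]
      push_cast
      rw [show ((k : ℝ≥0) + 1) * T + c = k * T + (c + T) by ring, add_tsub_cancel_left]
    rw [e] at this
    exact this.le

theorem flow_mul_backward_orbit {z : ℕ → X} (hz : ∀ k, f T (z (k + 1)) = z k) (m k : ℕ) :
    f (m * T) (z (k + m)) = z k := by
  induction m generalizing k with
  | zero => simp [f.map_zero_apply]
  | succ m ih =>
    have := ih (k + 1)
    rw [show k + (m + 1) = k + 1 + m by ring]
    push_cast
    rw [add_mul, one_mul, add_comm, f.map_add, this, hz]

end Chains

/-! ### Comparison of relaxation times -/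

section Times

variable {X : Type*} [MetricSpace X]

theorem le_finalEntry {g : ℝ≥0 → X} {W : Set X} {γ : ℝ} {t : ℝ≥0}
    (h : γ ≤ Metric.infDist (g t) W) : (t : ℝ≥0∞) ≤ finalEntry g W γ :=
  le_iInf₂ fun s hs => by
    by_contra! hst
    exact (hs t (by exact_mod_cast hst)).not_ge h

theorem le_firstEntry {g : ℝ≥0 → X} {W : Set X} {γ : ℝ} {t : ℝ≥0}
    (h : ∀ s < t, γ ≤ Metric.infDist (g s) W) : (t : ℝ≥0∞) ≤ firstEntry g W γ :=
  le_iInf₂ fun s hs => by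
    by_contra! hst
    exact (h s (by exact_mod_cast hst)).not_gt hs

theorem exists_lt_of_lt_finalEntry {g : ℝ≥0 → X} {W : Set X} {γ : ℝ} {t : ℝ≥0}
    (h : (t : ℝ≥0∞) < finalEntry g W γ) : ∃ s, t < s ∧ γ ≤ Metric.infDist (g s) W := by
  by_contra! hcon
  have h1 : finalEntry g W γ ≤ t := iInf₂_le (f := fun (t : ℝ≥0) _ => (t : ℝ≥0∞)) t hcon
  exact h1.not_gt h

theorem firstEntry_le_timeOutside (g : ℝ≥0 → X) (W : Set X) (γ : ℝ) :
    firstEntry g W γ ≤ timeOutside g W γ := by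
  refine ENNReal.le_of_forall_nnreal_lt fun t ht => ?_
  have hsub : Set.Ico (0 : ℝ) t ⊆
      (fun t : ℝ≥0 => (t : ℝ)) '' {t | γ ≤ Metric.infDist (g t) W} := by
    rintro r ⟨hr0, hrt⟩
    lift r to ℝ≥0 using hr0
    refine ⟨r, ?_, rfl⟩
    by_contra hcon
    have h1 : firstEntry g W γ ≤ r :=
      iInf₂_le (f := fun (t : ℝ≥0) _ => (t : ℝ≥0∞)) r (not_le.1 hcon)
    have h2 : (r : ℝ≥0∞) < t := by exact_mod_cast hrt
    exact (h1.trans_lt h2).not_ge ht.le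
  refine le_trans ?_ (MeasureTheory.measure_mono hsub)
  simp [Real.volume_Ico]

theorem timeOutside_le_finalEntry (g : ℝ≥0 → X) (W : Set X) (γ : ℝ) :
    timeOutside g W γ ≤ finalEntry g W γ := by
  refine le_iInf₂ fun t ht => ?_
  have hsub : (fun t : ℝ≥0 => (t : ℝ)) '' {t | γ ≤ Metric.infDist (g t) W} ⊆
      Set.Icc (0 : ℝ) t := by
    rintro _ ⟨r, hr, rfl⟩
    refine ⟨r.2, ?_⟩
    by_contra! hcon
    exact (ht r (by exact_mod_cast hcon)).not_ge hr
  refine (MeasureTheory.measure_mono hsub).trans ?_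
  simp [Real.volume_Icc]

variable {f : Flow ℝ≥0 X} {T : ℝ≥0}

/-- Nonemptiness matters: `Metric.infDist` to the empty set is `0`. -/
theorem finalEntry_totalOmegaEps_le {g : ℝ≥0 → X} {γ ε : ℝ} {x : X}
    (hne : (omegaEps f T ε x).Nonempty) :
    finalEntry g (totalOmegaEps f T ε) γ ≤ finalEntry g (omegaEps f T ε x) γ :=
  le_iInf₂ fun t ht => iInf₂_le t fun s hs =>
    (Metric.infDist_le_infDist_of_subset (Set.subset_iUnion _ x) hne).trans_lt (ht s hs)

theorem SlowRelaxations.mono {R R' : ℝ → X → (ℝ≥0 → X) → ℝ → ℝ≥0∞}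
    (h : ∀ ε x g γ, 0 < ε → R ε x g γ ≤ R' ε x g γ) (hR : SlowRelaxations f T R) :
    SlowRelaxations f T R' := by
  obtain ⟨γ, hγ, ε, x, g, hε, hε0, hg, hlim⟩ := hR
  exact ⟨γ, hγ, ε, x, g, hε, hε0, hg,
    tendsto_of_tendsto_of_tendsto_of_le_of_le hlim tendsto_const_nhds
      (fun j => h _ _ _ _ (hε j)) fun _ => le_top⟩

theorem TauOneSlow.tauTwoSlow (h : TauOneSlow f T) : TauTwoSlow f T :=
  SlowRelaxations.mono (fun _ _ _ _ _ => firstEntry_le_timeOutside _ _ _) h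

theorem TauTwoSlow.tauThreeSlow (h : TauTwoSlow f T) : TauThreeSlow f T :=
  SlowRelaxations.mono (fun _ _ _ _ _ => timeOutside_le_finalEntry _ _ _) h

theorem EtaThreeSlow.tauThreeSlow [CompactSpace X] (h : EtaThreeSlow f T) : TauThreeSlow f T :=
  SlowRelaxations.mono (fun _ x _ _ hε => finalEntry_totalOmegaEps_le (omegaEps_nonempty hε x)) h

theorem TauThreeSlow.exists_late_times (h : TauThreeSlow f T) :
    ∃ γ : ℝ, 0 < γ ∧ ∃ (ε : ℕ → ℝ) (x : ℕ → X) (g : ℕ → ℝ≥0 → X) (s : ℕ → ℝ≥0),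
      (∀ j, 0 < ε j) ∧ Tendsto ε atTop (𝓝 0) ∧ (∀ j, IsEpsMotion f T (ε j) (x j) (g j)) ∧
      Tendsto s atTop atTop ∧ ∀ j, γ ≤ Metric.infDist (g j (s j)) (omegaEps f T (ε j) (x j)) := by
  obtain ⟨γ, hγ, ε, x, g, hε, hε0, hg, hlim⟩ := h
  have hex : ∀ n : ℕ, ∃ j, n ≤ j ∧ ∃ s : ℝ≥0, n < s ∧
      γ ≤ Metric.infDist (g j s) (omegaEps f T (ε j) (x j)) := by
    intro n
    obtain ⟨j, hj, hnj⟩ := ((hlim.eventually (lt_mem_nhds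
      (ENNReal.coe_lt_top (r := (n : ℝ≥0))))).and (eventually_ge_atTop n)).exists
    exact ⟨j, hnj, exists_lt_of_lt_finalEntry hj⟩
  choose φ hφ s hs hd using hex
  refine ⟨γ, hγ, ε ∘ φ, x ∘ φ, fun n => g (φ n), s, fun _ => hε _,
    hε0.comp (tendsto_atTop_mono hφ tendsto_id), fun _ => hg _, ?_, hd⟩
  exact tendsto_atTop_mono (fun n => (hs n).le) tendsto_natCast_atTop_atTop

end Times

/-! ### The connected and disconnected cases -/

section Main

variable {X : Type*} [MetricSpace X] [CompactSpace X] {f : Flow ℝ≥0 X} {T : ℝ≥0}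

/-- By perturbing a loop at a recurrent point, nearby points are joined to it both ways by
`δ`-chains; connectedness propagates this transitive relation. -/
theorem chainReach_of_isPreconnected (hT : 0 < T) (hc : IsPreconnected (totalOmegaZero f T))
    {p q : X} (hp : p ∈ totalOmegaZero f T) (hq : q ∈ totalOmegaZero f T) :
    ChainReach f T p q := by
  intro δ hδ
  obtain ⟨δ', hδ', hpert⟩ := exists_epsChain_perturb f T hδ
  refine hc.induction₂' (EpsChain f T δ) (fun x hx => ?_)
    (fun _ _ _ _ _ _ h1 h2 => h1.trans h2) hp hq
  filter_upwards [mem_nhdsWithin_of_mem_nhds (Metric.ball_mem_nhds x hδ')] with y hy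
  have hxx := (mem_totalOmegaZero_iff hT).1 hx δ' hδ'
  exact ⟨hpert x x x y hxx (by simpa using hδ') (by rwa [dist_comm]),
    hpert x y x x hxx hy (by simpa using hδ')⟩

theorem chainReach_backward_orbit (hT : 0 < T) {z : ℕ → X} (hz : ∀ k, f T (z (k + 1)) = z k)
    {k l : ℕ} (h : k < l) : ChainReach f T (z l) (z k) := by
  obtain ⟨m, rfl⟩ := Nat.exists_eq_add_of_lt h
  have := chainReach_flow (f := f) hT (t := ((m + 1 : ℕ) : ℝ≥0) * T) ?_ (z (k + (m + 1)))
  · rwa [flow_mul_backward_orbit hz] at this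
  · push_cast
    rw [add_mul, one_mul]
    exact le_add_self

/-- A limit point `q` of the backward orbit is recurrent and reaches `z 0`; `z 0` reaches some
recurrent `p`, and `p` reaches `q` by connectedness. This closes a loop at `z 0`. -/
theorem mem_totalOmegaZero_of_backward_orbit (hT : 0 < T)
    (hc : IsPreconnected (totalOmegaZero f T)) {z : ℕ → X} (hz : ∀ k, f T (z (k + 1)) = z k) :
    z 0 ∈ totalOmegaZero f T := by
  obtain ⟨q, φ, hφ, hq⟩ := CompactSpace.tendsto_subseq z
  have hq0 : ChainReach f T q (z 0) := by
    refine ChainReach.of_frequently_nhds (Eventually.frequently ?_ |>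
      (hq.prodMk_nhds tendsto_const_nhds).frequently)
    filter_upwards [hφ.tendsto_atTop.eventually_gt_atTop 0] with n hn
    exact chainReach_backward_orbit hT hz hn
  have hqq : ChainReach f T q q := by
    intro δ hδ
    obtain ⟨δ', hδ', hpert⟩ := exists_epsChain_perturb f T hδ
    have hb := hq.eventually (Metric.ball_mem_nhds q hδ')
    obtain ⟨n, hn⟩ := hb.exists
    obtain ⟨m, hm, hnm⟩ := (hb.and (eventually_gt_atTop n)).exists
    exact hpert _ _ _ _ (chainReach_backward_orbit hT hz (hφ hnm) δ' hδ')
      (by rw [dist_comm]; exact hm) hn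
  obtain ⟨p, hp⟩ := omegaZero_nonempty (f := f) (T := T) (z 0)
  have hp' := (mem_omegaZero_iff hT).1 hp
  have hpq := chainReach_of_isPreconnected hT hc ((mem_totalOmegaZero_iff hT).2 hp'.2)
    ((mem_totalOmegaZero_iff hT).2 hqq)
  exact (mem_totalOmegaZero_iff hT).2 (hp'.1.trans (hpq.trans hq0))

theorem totalOmegaZero_subset_omegaZero (hT : 0 < T) (hc : IsPreconnected (totalOmegaZero f T))
    (x : X) : totalOmegaZero f T ⊆ omegaZero f T x := by
  intro c hcm
  obtain ⟨p, hp⟩ := omegaZero_nonempty (f := f) (T := T) x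
  have hp' := (mem_omegaZero_iff hT).1 hp
  exact (mem_omegaZero_iff hT).2 ⟨hp'.1.trans (chainReach_of_isPreconnected hT hc
    ((mem_totalOmegaZero_iff hT).2 hp'.2) hcm), (mem_totalOmegaZero_iff hT).1 hcm⟩

theorem not_tauThreeSlow (hT : 0 < T) (hc : IsPreconnected (totalOmegaZero f T)) :
    ¬ TauThreeSlow f T := by
  intro h
  obtain ⟨γ, hγ, ε, x, g, s, hε, hε0, hg, hs, hd⟩ := h.exists_late_times
  have hU := Ultrafilter.of_le (atTop : Filter ℕ)
  set U := Ultrafilter.of (atTop : Filter ℕ)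
  obtain ⟨y, -, hy⟩ := isCompact_univ.ultrafilter_le_nhds (U.map fun j => g j (s j)) (by simp)
  replace hy : Tendsto (fun j => g j (s j)) U (𝓝 y) := hy
  obtain ⟨z, rfl, hz⟩ := exists_backward_orbit hU hε0 hg hs hy
  have hz0 := mem_totalOmegaZero_of_backward_orbit hT hc hz
  obtain ⟨j, hj⟩ := (hy.eventually (Metric.ball_mem_nhds (z 0) hγ)).exists
  have h1 := Metric.infDist_le_dist_of_mem (x := g j (s j))
    (totalOmegaZero_subset_omegaZero hT hc (x j) hz0 (ε j) (hε j))
  exact ((hd j).trans h1).not_gt hj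

/-- A recurrent point is a limit of late points of motions with errors tending to `0`, so it has a
backward orbit. -/
theorem totalOmegaZero_subset_range (hT : 0 < T) (n : ℕ) :
    totalOmegaZero f T ⊆ Set.range (f (n * T)) := by
  intro p hp
  have hp0 := (mem_omegaZero_iff hT).2
    ⟨(mem_totalOmegaZero_iff hT).1 hp, (mem_totalOmegaZero_iff hT).1 hp⟩
  choose g hg hlim using fun j : ℕ => hp0 (1 / (j + 1)) Nat.one_div_pos_of_nat
  choose t ht htp using hlim
  have hex : ∀ j : ℕ, ∃ s : ℝ≥0, (j : ℝ≥0) ≤ s ∧ dist (g j s) p < 1 / (j + 1) := fun j => by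
    obtain ⟨i, h1, h2⟩ := (((ht j).eventually_ge_atTop (j : ℝ≥0)).and
      ((htp j).eventually (Metric.ball_mem_nhds p
        (Nat.one_div_pos_of_nat (α := ℝ) (n := j))))).exists
    exact ⟨_, h1, h2⟩
  choose s hs hsp using hex
  have hp : Tendsto (fun j => g j (s j)) atTop (𝓝 p) :=
    tendsto_iff_dist_tendsto_zero.2 (squeeze_zero (fun _ => dist_nonneg) (fun j => (hsp j).le)
      tendsto_one_div_add_atTop_nhds_zero_nat)
  obtain ⟨z, rfl, hz⟩ := exists_backward_orbit (Ultrafilter.of_le atTop)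
    tendsto_one_div_add_atTop_nhds_zero_nat hg
    (tendsto_atTop_mono hs tendsto_natCast_atTop_atTop) (hp.mono_left (Ultrafilter.of_le atTop))
  exact ⟨z (0 + n), flow_mul_backward_orbit hz n 0⟩

theorem antitone_range_flow {X : Type*} [MetricSpace X] (f : Flow ℝ≥0 X) (T : ℝ≥0) :
    Antitone fun n : ℕ => Set.range (f (n * T)) := by
  intro m n hmn
  obtain ⟨k, rfl⟩ := Nat.exists_eq_add_of_le hmn
  rintro _ ⟨x, rfl⟩
  refine ⟨f (k * T) x, ?_⟩
  rw [← f.map_add]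
  push_cast
  rw [add_mul]

theorem isConnected_iInter_range_flow [ConnectedSpace X] (f : Flow ℝ≥0 X) (T : ℝ≥0) :
    IsConnected (⋂ n : ℕ, Set.range (f (n * T))) := by
  have hcont : ∀ t, Continuous (f t) := fun t => f.continuous continuous_const continuous_id
  have hcpt : ∀ n : ℕ, IsCompact (Set.range (f (n * T))) := fun n => isCompact_range (hcont _)
  have hdir : Directed (· ⊇ ·) fun n : ℕ => Set.range (f (n * T)) :=
    (antitone_range_flow f T).directed_ge
  refine ⟨IsCompact.nonempty_iInter_of_directed_nonempty_isCompact_isClosed _ hdir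
    (fun n => Set.range_nonempty _) hcpt fun n => (hcpt n).isClosed, ?_⟩
  have hcl : IsClosed (⋂ n : ℕ, Set.range (f (n * T))) :=
    isClosed_iInter fun n => (hcpt n).isClosed
  refine (isPreconnected_iff_subset_of_fully_disjoint_closed hcl).2 fun A B hA hB hAB hd => ?_
  obtain ⟨U, V, hU, hV, hAU, hBV, hUV⟩ := normal_separation hA hB hd
  obtain ⟨n, hn⟩ := exists_subset_nhds_of_isCompact hdir hcpt fun x hx =>
    (hU.union hV).mem_nhds (Set.union_subset_union hAU hBV (hAB hx))
  rcases (isPreconnected_range (hcont (n * T))).subset_or_subset hU hV hUV hn with h | h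
  · refine Or.inl fun x hx => (hAB hx).resolve_right fun hxB => ?_
    exact Set.disjoint_left.1 hUV (h (Set.mem_iInter.1 hx n)) (hBV hxB)
  · refine Or.inr fun x hx => (hAB hx).resolve_left fun hxA => ?_
    exact Set.disjoint_left.1 hUV (hAU hxA) (h (Set.mem_iInter.1 hx n))

theorem exists_backward_orbit_not_mem [ConnectedSpace X]
    (hf : ∀ t : ℝ≥0, Function.Injective (f t)) (hT : 0 < T)
    (hc : ¬ IsConnected (totalOmegaZero f T)) :
    ∃ z : ℕ → X, (∀ k, f T (z (k + 1)) = z k) ∧ z 0 ∉ totalOmegaZero f T := by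
  have hI := isConnected_iInter_range_flow f T
  obtain ⟨y, hyI, hy⟩ : ∃ y ∈ ⋂ n : ℕ, Set.range (f (n * T)), y ∉ totalOmegaZero f T := by
    by_contra! hcon
    have : totalOmegaZero f T = ⋂ n : ℕ, Set.range (f (n * T)) :=
      (Set.subset_iInter fun n => totalOmegaZero_subset_range hT n).antisymm hcon
    exact hc (this ▸ hI)
  choose z hz using Set.mem_iInter.1 hyI
  -- The preimages `z k` of `y` were chosen independently; injectivity makes them one backward
  -- orbit.
  refine ⟨z, fun k => hf (k * T) ?_, ?_⟩
  · rw [hz k, ← f.map_add, ← hz (k + 1)]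
    push_cast
    rw [add_mul, one_mul]
  · have := hz 0
    rw [Nat.cast_zero, zero_mul, f.map_zero_apply] at this
    rwa [this]

theorem etaThreeSlow_of_backward_orbit (hT : 0 < T) {z : ℕ → X}
    (hz : ∀ k, f T (z (k + 1)) = z k) (h0 : z 0 ∉ totalOmegaZero f T) : EtaThreeSlow f T := by
  obtain ⟨γ, hγ, hd⟩ := Metric.nhds_basis_closedBall.mem_iff.1
    ((isClosed_totalOmegaZero hT).isOpen_compl.mem_nhds h0)
  obtain ⟨ε, hε, hdis⟩ := exists_disjoint_totalOmegaEps hT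
    (Metric.isClosed_closedBall (x := z 0) (ε := γ)).isCompact
    (Set.disjoint_left.2 fun _ hp => hd hp)
  have hlim : Tendsto (fun j : ℕ => min ε (1 / ((j : ℝ) + 1))) atTop (𝓝 0) := by
    simpa [hε.le] using (tendsto_const_nhds (x := ε)).min
      (tendsto_one_div_add_atTop_nhds_zero_nat (𝕜 := ℝ))
  have hpos : ∀ j : ℕ, 0 < min ε (1 / ((j : ℝ) + 1)) :=
    fun j => lt_min hε Nat.one_div_pos_of_nat
  refine ⟨γ, hγ, _, z, fun j t => f t (z j), hpos, hlim,
    fun j => isEpsMotion_orbit (hpos j) _, ?_⟩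
  refine tendsto_nhds_top_mono' (f := fun j : ℕ => ((j * T : ℝ≥0) : ℝ≥0∞)) ?_ fun j => ?_
  · exact ENNReal.tendsto_coe_nhds_top.2 (tendsto_natCast_atTop_atTop.atTop_mul_const hT)
  · refine le_finalEntry ?_
    have := flow_mul_backward_orbit hz j 0
    rw [zero_add] at this
    change γ ≤ Metric.infDist (f (j * T) (z j)) _
    rw [this]
    refine (Metric.le_infDist ?_).2 fun p hp => ?_
    · exact (omegaEps_nonempty (hpos j) (z 0)).mono (Set.subset_iUnion _ _)
    · by_contra! hlt
      refine Set.disjoint_left.1 hdis ?_ (totalOmegaEps_mono (min_le_left _ _) hp)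
      rw [Metric.mem_closedBall, dist_comm]
      exact hlt.le

theorem tauOneSlow_of_backward_orbit (hT : 0 < T) {z : ℕ → X}
    (hz : ∀ k, f T (z (k + 1)) = z k) (h0 : z 0 ∉ totalOmegaZero f T) : TauOneSlow f T := by
  have hM : IsClosed {p | ChainReach f T p (z 0)} :=
    (isClosed_chainReach f T).preimage (f := fun p => (p, z 0)) (by fun_prop)
  have hW : IsClosed {p | ChainReach f T (z 0) p} :=
    (isClosed_chainReach f T).preimage (f := fun p => (z 0, p)) (by fun_prop)
  have hMW : Disjoint {p | ChainReach f T p (z 0)} {p | ChainReach f T (z 0) p} :=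
    Set.disjoint_left.2 fun p h1 h2 => h0 ((mem_totalOmegaZero_iff hT).2 (h2.trans h1))
  obtain ⟨γ, hγ, hd⟩ := hMW.exists_cthickenings hM.isCompact hW
  have hK : IsCompact (Metric.cthickening γ {p | ChainReach f T p (z 0)}) :=
    Metric.isClosed_cthickening.isCompact
  have hsub : ∀ k, omegaZero f T (z k) ⊆ {p | ChainReach f T (z 0) p} := fun k p hp => by
    have h1 := omegaZero_subset_omegaZero_flow_mul hT k _ hp
    have h2 := flow_mul_backward_orbit hz k 0
    rw [zero_add] at h2
    rw [h2] at h1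
    exact ((mem_omegaZero_iff hT).1 h1).1
  -- The threshold depends on `k`: semicontinuity of `ω^ε (z k)` at `0` is used for each point
  -- separately.
  choose ε hε hdis using fun k => exists_disjoint_omegaEps hT hK
    (hd.mono_right ((hsub k).trans (Metric.self_subset_cthickening _)))
  have hpos : ∀ j : ℕ, 0 < min (ε j) (1 / ((j : ℝ) + 1)) :=
    fun j => lt_min (hε j) Nat.one_div_pos_of_nat
  have hlim : Tendsto (fun j : ℕ => min (ε j) (1 / ((j : ℝ) + 1))) atTop (𝓝 0) :=
    squeeze_zero (fun j => (hpos j).le) (fun j => min_le_right _ _)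
      tendsto_one_div_add_atTop_nhds_zero_nat
  -- The shift to `z (j + 1)` leaves at least time `T` before `z 0` whenever `t < j * T`, as
  -- `chainReach_flow` needs.
  refine ⟨γ, hγ, fun j => min (ε (j + 1)) (1 / (((j + 1 : ℕ) : ℝ) + 1)), fun j => z (j + 1),
    fun j t => f t (z (j + 1)), fun j => hpos _, hlim.comp (tendsto_add_atTop_nat 1),
    fun j => isEpsMotion_orbit (hpos _) _, ?_⟩
  refine tendsto_nhds_top_mono' (f := fun j : ℕ => ((j * T : ℝ≥0) : ℝ≥0∞)) ?_ fun j => ?_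
  · exact ENNReal.tendsto_coe_nhds_top.2 (tendsto_natCast_atTop_atTop.atTop_mul_const hT)
  · refine le_firstEntry fun t ht => ?_
    obtain ⟨r, hr⟩ := exists_add_of_le ht.le
    have hmem : ChainReach f T (f t (z (j + 1))) (z 0) := by
      have h1 := flow_mul_backward_orbit hz (j + 1) 0
      rw [zero_add] at h1
      have h2 : f (r + T) (f t (z (j + 1))) = z 0 := by
        rw [← f.map_add, ← h1]
        congr 1
        push_cast
        rw [add_mul, one_mul, hr]
        ring
      have h3 := chainReach_flow (f := f) hT (le_add_self : T ≤ r + T) (f t (z (j + 1)))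
      rwa [h2] at h3
    refine (Metric.le_infDist (omegaEps_nonempty (hpos _) _)).2 fun p hp => ?_
    by_contra! hlt
    refine Set.disjoint_left.1 (hdis (j + 1)) ?_ (omegaEps_mono (min_le_left _ _) _ hp)
    refine Metric.mem_cthickening_of_dist_le p _ γ _ hmem ?_
    rw [dist_comm]
    exact hlt.le

end Main

end Perturbed

theorem theorem4p6 {X : Type*} [MetricSpace X] [CompactSpace X] [ConnectedSpace X]
    (f : Flow ℝ≥0 X) (hf : ∀ t : ℝ≥0, Function.Injective (f t))
    (T : ℝ≥0) (hT : 0 < T) :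
    (IsConnected (Perturbed.totalOmegaZero f T) →
      ¬ Perturbed.TauOneSlow f T ∧ ¬ Perturbed.TauTwoSlow f T ∧
      ¬ Perturbed.TauThreeSlow f T ∧ ¬ Perturbed.EtaThreeSlow f T) ∧
    (¬ IsConnected (Perturbed.totalOmegaZero f T) →
      Perturbed.TauOneSlow f T ∧ Perturbed.TauTwoSlow f T ∧
      Perturbed.TauThreeSlow f T ∧ Perturbed.EtaThreeSlow f T) := by
  refine ⟨fun hc => ?_, fun hc => ?_⟩
  · have h3 := Perturbed.not_tauThreeSlow hT hc.isPreconnected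
    exact ⟨fun h => h3 h.tauTwoSlow.tauThreeSlow, fun h => h3 h.tauThreeSlow, h3,
      fun h => h3 h.tauThreeSlow⟩
  · obtain ⟨z, hz, h0⟩ := Perturbed.exists_backward_orbit_not_mem hf hT hc
    have h1 := Perturbed.tauOneSlow_of_backward_orbit hT hz h0
    exact ⟨h1, h1.tauTwoSlow, h1.tauTwoSlow.tauThreeSlow,
      Perturbed.etaThreeSlow_of_backward_orbit hT hz h0⟩
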